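/- Notation: $(z)_n=z(z+1)\cdots(z+n-1)$, $(z)_0=1$, for $z\in\mathbb{C}$ and integers $n\ge 0$. Let $r\ge 1$, let $\mathbf{m}=(m_1,\dots,m_r)$ be a vector of positive integers, put $m=m_1+\dots+m_r$, and let $a,b\in\mathbb{C}$ and $\mathbf{f}=(f_1,\dots,f_r)\in\mathbb{C}^r$. Write $\mathbf{f}+\mathbf{m}=(f_1+m_1,\dots,f_r+m_r)$, $(\mathbf{f})_{\mathbf{m}}=\prod_{i=1}^r (f_i)_{m_i}$ and $(\mathbf{f}-a)_{\mathbf{m}}=\prod_{i=1}^r (f_i-a)_{m_i}$. For $x\in\mathbb{C}\setminus[1,\infty)$ the generalized hypergeometric functions ${}_{r+2}F_{r+1}(\cdot\,;\cdot\,;x)$ and ${}_2F_1(\cdot\,;\cdot\,;x)$ below denote the analytic continuations to $\mathbb{C}\setminus[1,\infty)$ of the hypergeometric series, which converge for $|x|<1$ (that the continuations exist is part of the claim); powers of $1-x$ are principal values. For integers $k\ge 0$ put $$C_{k,r}=\frac{(-1)^k}{k!}\,{}_{r+1}F_r\left(-k,\mathbf{f}+\mathbf{m};\mathbf{f};1\right),$$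 and for $j=0,1,\dots,m-1$ put $$\hat Q^0_m(-j)=\sum_{k=0}^{j}\frac{(-1)^k(-j)_k(a)_k(b)_k\,C_{k,r}}{(1-m)_k\,(a-b-m+1)_k}\;{}_3F_2\left(k-m,\,k-j,\,1-b-m;\;k-m+1,\,a-b-m+k+1;\;1\right),$$ where the ${}_{r+1}F_r$ and ${}_3F_2$ are the finite sums of the terms of index $0,\dots,k$ and $0,\dots,j-k$, respectively, of their terminating series. Suppose that no $f_i$ is a non-positive integer, that $a+1\notin\{0,-1,-2,\dots\}$, that $a-b\notin\{0,1,\dots,m-1\}$, and that $f_i-a\notin\{1-m_i,2-m_i,\dots,0\}$ for $1\le i\le r$. Then for all $x\in\mathbb{C}\setminus[1,\infty)$ $$(1-x)^{b+m-1}\,{}_{r+2}F_{r+1}\left(a,b,\mathbf{f}+\mathbf{m};\,a+1,\mathbf{f};\,x\right)=\sum_{j=0}^{m-1}\frac{(1-m)_j\,(a-b-m+1)_j}{(a+1)_j\,j!}\,\hat Q^0_m(-j)\,x^j+\frac{x^m(-1)^m(b)_m(\mathbf{f}-a)_{\mathbf{m}}}{(a+1)_m(\mathbf{f})_{\mathbf{m}}}\;{}_2F_1\left(1,\,1-b+a;\,a+m+1;\,x\right).$$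 -/

import Mathlib

open scoped Nat

noncomputable section

namespace GenHyp

/-- The Pochhammer symbol (rising factorial) `(z)_n = z (z + 1) ⋯ (z + n - 1)`. -/
def poch (z : ℂ) (n : ℕ) : ℂ := (ascPochhammer ℂ n).eval z

/-- The `n`-th Taylor coefficient of `_{q+1}F_q(A; B; x)`, that is
`(A_0)_n ⋯ (A_q)_n / ((B_1)_n ⋯ (B_q)_n n!)`. -/
def coeff {q : ℕ} (A : Fin (q + 1) → ℂ) (B : Fin q → ℂ) (n : ℕ) : ℂ :=
  (∏ i, poch (A i) n) / ((∏ i, poch (B i) n) * (n ! : ℂ))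

/-- The cut plane `ℂ ∖ [1, ∞)`. -/
def cutPlane : Set ℂ := {x : ℂ | ∀ t : ℝ, 1 ≤ t → x ≠ (t : ℂ)}

/-- `F` is the function `_{q+1}F_q(A; B; ·)` on `ℂ ∖ [1, ∞)`: it is holomorphic there, and on the
open unit disc it is the sum of the (convergent) hypergeometric series. Since the cut plane is
connected, at most one function on the cut plane has this property. -/
structure IsHypergeometric {q : ℕ} (A : Fin (q + 1) → ℂ) (B : Fin q → ℂ) (F : ℂ → ℂ) : Prop where
  differentiableOn : DifferentiableOn ℂ F cutPlane
  hasSum : ∀ x : ℂ, ‖x‖ < 1 → HasSum (fun n : ℕ => coeff A B n * x ^ n) (F x)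

open Classical in
/-- The generalized hypergeometric function `_{q+1}F_q(A; B; x)` on the cut plane `ℂ ∖ [1, ∞)`: the
analytic continuation of the hypergeometric series. Its values on `[1, ∞)` have no meaning, and
neither has the default value `0`, which is taken if there is no such continuation. -/
def pFq {q : ℕ} (A : Fin (q + 1) → ℂ) (B : Fin q → ℂ) : ℂ → ℂ :=
  if h : ∃ F : ℂ → ℂ, IsHypergeometric A B F then h.choose else 0

/-- The value `_{q+1}F_q(A; B; 1)` as the sum of the hypergeometric series at `1`. It is used below
only for terminating series: some `A_i` is `-N` with `N` a natural number, and no `(B_i)_n` with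
`n ≤ N` vanishes. The sum is then finite, the terms with `n > N` being `0`. -/
def pFqOne {q : ℕ} (A : Fin (q + 1) → ℂ) (B : Fin q → ℂ) : ℂ :=
  ∑' n : ℕ, coeff A B n

/-- The vector `f + m`. -/
def shift {r : ℕ} (f : Fin r → ℂ) (m : Fin r → ℕ) : Fin r → ℂ := fun i => f i + (m i : ℂ)

/-- The product `(f)_m = (f_1)_{m_1} ⋯ (f_r)_{m_r}`. -/
def vpoch {r : ℕ} (f : Fin r → ℂ) (m : Fin r → ℕ) : ℂ := ∏ i, poch (f i) (m i)

/-- The numbers `C_{k,r} = ((-1)^k / k!) _{r+1}F_r(-k, f + m; f; 1)`. -/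
def Ckr {r : ℕ} (f : Fin r → ℂ) (m : Fin r → ℕ) (k : ℕ) : ℂ :=
  (-1) ^ k / (k ! : ℂ) * pFqOne (Fin.cons (-(k : ℂ)) (shift f m)) f

/-- The values `Q̂⁰_m(-j)`, where `M` is the sum of the `m_i`. -/
def Qhat {r : ℕ} (a b : ℂ) (f : Fin r → ℂ) (m : Fin r → ℕ) (M j : ℕ) : ℂ :=
  ∑ k ∈ Finset.range (j + 1),
    (-1) ^ k * poch (-(j : ℂ)) k * poch a k * poch b k * Ckr f m k
      / (poch (1 - (M : ℂ)) k * poch (a - b - (M : ℂ) + 1) k)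
      * pFqOne ![(k : ℂ) - (M : ℂ), (k : ℂ) - (j : ℂ), 1 - b - (M : ℂ)]
          ![(k : ℂ) - (M : ℂ) + 1, a - b - (M : ℂ) + (k : ℂ) + 1]

end GenHyp

end

/-! ### Pochhammer symbols and the finite sum behind the coefficients. -/

namespace GenHyp

open Finset

/-! Let `p` be the polynomial of degree at most `M` with `p(n) = ∏ (f_i + m_i)_n / (f_i)_n`. The
`C_{k,r}` are its Newton coefficients at `0, 1, 2, …` (`newton_interpolation`), so `∑ (b)_n p(n) xⁿ
/ n! = (1 - x)^(-b-M) N(x)` with `N = ∑ C_k (b)_k x^k (1 - x)^(M-k)` of degree at most `M`. Since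
`(a)_n / (a + 1)_n = a / (a + n)` for `n ≥ 1`, the series `F` on the left satisfies `(x d/dx + a) F
= a (1 - x)^(-b-M) N`.

For `G = (1 - x)^(b+M-1) F` this becomes the recurrence `(n+1+a) g_{n+1} - (n+1+a-b-M) g_n = a
N_{n+1}`. From `n = M` on it is homogeneous and produces the `₂F₁`, with leading coefficient
proportional to `p(-a) = (f - a)_m / (f)_m`. Below `M` it is solved explicitly by `euler_succ_add`,
a consequence of Chu–Vandermonde, and `coefficient_eq_euler` identifies that solution with the `₃F₂`
sums.

The argument runs backwards: the right-hand side, continued by Euler's integral for the `₂F₁`, is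
divided by the power of `1 - x` and shown to have the hypergeometric coefficients. This yields the
continuation of `F` and the formula at once. -/

theorem poch_zero (z : ℂ) : poch z 0 = 1 := by simp [poch]

theorem poch_succ (z : ℂ) (n : ℕ) : poch z (n + 1) = poch z n * (z + n) := by
  simp [poch, ascPochhammer_succ_eval]

theorem poch_succ_left (z : ℂ) (n : ℕ) : poch z (n + 1) = z * poch (z + 1) n := by
  simp [poch, ascPochhammer_succ_left]

theorem poch_add (z : ℂ) (m n : ℕ) : poch z (m + n) = poch z m * poch (z + m) n := by
  induction n with
  | zero => simp [poch_zero]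
  | succ n ih =>
    rw [← add_assoc, poch_succ, ih, poch_succ]
    push_cast
    ring

theorem poch_ne_zero {z : ℂ} {n : ℕ} (h : ∀ i < n, z ≠ -(i : ℂ)) : poch z n ≠ 0 := by
  induction n with
  | zero => simp [poch_zero]
  | succ n ih =>
    rw [poch_succ]
    refine mul_ne_zero (ih fun i hi => h i (by omega)) fun h0 => ?_
    exact h n (by omega) (eq_neg_of_add_eq_zero_left h0)

theorem poch_neg_natCast (j n : ℕ) :
    poch (-(j : ℂ)) n = (-1) ^ n * (j.descFactorial n : ℂ) := by
  induction n with
  | zero => simp [poch_zero]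
  | succ n ih =>
    rw [poch_succ, ih, Nat.descFactorial_succ]
    rcases le_or_gt n j with h | h
    · push_cast [h]
      ring
    · simp [Nat.descFactorial_eq_zero_iff_lt.2 h]

theorem poch_neg_natCast_eq_zero {j n : ℕ} (h : j < n) : poch (-(j : ℂ)) n = 0 := by
  rw [poch_neg_natCast, Nat.descFactorial_eq_zero_iff_lt.2 h]
  simp

/-- The reflection formula `(-1)ⁿ (1 - z)ₙ = (z - n)ₙ`. -/
theorem neg_one_pow_mul_poch_one_sub (z : ℂ) (n : ℕ) :
    (-1) ^ n * poch (1 - z) n = poch (z - n) n := by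
  induction n with
  | zero => simp [poch_zero]
  | succ n ih =>
    rw [poch_succ, poch_succ_left, show z - ((n + 1 : ℕ) : ℂ) + 1 = z - n by push_cast; ring, ← ih]
    push_cast
    ring

/-- The Chu–Vandermonde identity. -/
theorem sum_choose_mul_poch_mul_poch (J : ℕ) (x y : ℂ) :
    ∑ i ∈ range (J + 1), (J.choose i : ℂ) * (-1) ^ i * poch x i * poch (y + i) (J - i)
      = poch (y - x) J := by
  induction J generalizing y with
  | zero => simp [poch_zero]
  | succ J ih =>
    rw [poch_succ_left, show y - x + 1 = (y + 1) - x by ring, ← ih (y + 1), sum_range_succ',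
      mul_sum]
    have h1 : ∀ i ∈ range (J + 1),
        ((J + 1).choose (i + 1) : ℂ) * (-1) ^ (i + 1) * poch x (i + 1)
            * poch (y + ((i + 1 : ℕ) : ℂ)) (J + 1 - (i + 1))
          = -((J.choose i : ℂ) * (-1) ^ i * poch x i * (x + i) * poch (y + 1 + i) (J - i))
            + (J.choose (i + 1) : ℂ) * (-1) ^ (i + 1) * poch x (i + 1)
              * poch (y + ((i + 1 : ℕ) : ℂ)) (J + 1 - (i + 1)) := by
      intro i _
      rw [Nat.choose_succ_succ, poch_succ, Nat.succ_sub_succ]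
      push_cast
      rw [show y + ((i : ℂ) + 1) = y + 1 + i by ring]
      ring
    rw [sum_congr rfl h1, sum_add_distrib, add_assoc]
    have h2 : ∑ i ∈ range (J + 1), (J.choose (i + 1) : ℂ) * (-1) ^ (i + 1) * poch x (i + 1)
              * poch (y + ((i + 1 : ℕ) : ℂ)) (J + 1 - (i + 1))
          + ((J + 1).choose 0 : ℂ) * (-1) ^ 0 * poch x 0 * poch (y + ((0 : ℕ) : ℂ)) (J + 1 - 0)
        = ∑ i ∈ range (J + 1), (J.choose i : ℂ) * (-1) ^ i * poch x i
            * ((y + i) * poch (y + 1 + i) (J - i)) := by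
      have := sum_range_succ' (fun i => (J.choose i : ℂ) * (-1) ^ i * poch x i
              * poch (y + (i : ℂ)) (J + 1 - i)) (J + 1)
      rw [show (J + 1).choose 0 = J.choose 0 by simp, ← this, sum_range_succ]
      rw [Nat.choose_succ_self, Nat.cast_zero, zero_mul, zero_mul, zero_mul, add_zero]
      refine sum_congr rfl fun i hi => ?_
      rw [Nat.succ_sub (Nat.lt_succ_iff.1 (mem_range.1 hi)), poch_succ_left,
        show y + (i : ℂ) + 1 = y + 1 + i by ring]
    rw [h2, ← sum_add_distrib]
    exact sum_congr rfl fun i _ => by ring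

/-- Up to the factor `(-1) ^ J / (A + 1)_J`, the solution of the two-term recurrence of
`euler_succ_add`. -/
noncomputable def euler (N J : ℕ) (A B : ℂ) : ℂ :=
  ∑ i ∈ range (J + 1), (N.choose i : ℂ) * ((N - i - 1).choose (J - i) : ℂ) * (-1) ^ i
    * poch (1 - B) i * poch (A - B + 1 + i) (J - i)

theorem euler_zero (N : ℕ) (A B : ℂ) : euler N 0 A B = 1 := by
  simp [euler, poch_zero]

/-- For `i < N` the factor `(N - i - 1).choose (N - i)` vanishes; at `i = N` truncated subtraction
makes it `(0).choose 0 = 1`, so one term survives. -/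
theorem euler_self (N : ℕ) (A B : ℂ) : euler N N A B = poch (B - N) N := by
  rw [euler, sum_range_succ, sum_eq_zero]
  · simp [poch_zero, neg_one_pow_mul_poch_one_sub]
  · intro i hi
    rw [Nat.choose_eq_zero_of_lt (n := N - i - 1) (by have := mem_range.1 hi; omega)]
    simp

/-- Termwise, Pascal's rule merges the two binomials into `(N - i).choose (J + 1 - i)`. Its product
with `N.choose i` is `N.choose (J + 1) * (J + 1).choose i`, which leaves a Chu–Vandermonde sum with
`y - x = A`. -/
theorem euler_succ_add (N J : ℕ) (h : J + 1 ≤ N) (A B : ℂ) :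
    euler N (J + 1) A B + ((J : ℂ) + 1 + A - B) * euler N J A B
      = (N.choose (J + 1) : ℂ) * poch A (J + 1) := by
  have hcv := sum_choose_mul_poch_mul_poch (J + 1) (1 - B) (A - B + 1)
  rw [show A - B + 1 - (1 - B) = A by ring] at hcv
  rw [← hcv, euler, euler, sum_range_succ, sum_range_succ _ (J + 1), mul_sum, mul_add,
    add_right_comm, ← sum_add_distrib, mul_sum]
  congr 1
  · refine sum_congr rfl fun i hi => ?_
    have hi := mem_range.1 hi
    have h1 : J + 1 - i = (J - i) + 1 := by omega
    have h2 : N - i = (N - i - 1) + 1 := by omega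
    have h3 : N.choose i * (N - i).choose (J + 1 - i) = N.choose (J + 1) * (J + 1).choose i := by
      exact (Nat.choose_mul (by omega)).symm
    have h4 : (N - i).choose (J + 1 - i)
        = (N - i - 1).choose (J - i) + (N - i - 1).choose (J + 1 - i) := by
      rw [h1]
      conv_lhs => rw [h2]
      exact Nat.choose_succ_succ _ _
    rw [h4] at h3
    have h5 : (N.choose i : ℂ) * ((N - i - 1).choose (J - i) + (N - i - 1).choose (J + 1 - i))
        = N.choose (J + 1) * (J + 1).choose i := by exact_mod_cast h3
    have h6 : poch (A - B + 1 + i) (J + 1 - i)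
        = poch (A - B + 1 + i) (J - i) * ((J : ℂ) + 1 + A - B) := by
      rw [h1, poch_succ, Nat.cast_sub (by omega)]
      ring
    rw [h6]
    linear_combination (-1) ^ i * poch (1 - B) i * poch (A - B + 1 + i) (J - i)
      * ((J : ℂ) + 1 + A - B) * h5
  · simp
    ring

/-- The terms `n > N` of a series terminated by `A 0 = -N` vanish. -/
theorem pFqOne_eq_sum {q : ℕ} (A : Fin (q + 1) → ℂ) (B : Fin q → ℂ) (l : Fin (q + 1)) (N : ℕ)
    (h : A l = -(N : ℂ)) : pFqOne A B = ∑ n ∈ range (N + 1), coeff A B n := by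
  refine tsum_eq_sum fun n hn => ?_
  have hn : N < n := by simpa using hn
  rw [coeff, Finset.prod_eq_zero (mem_univ l), zero_div]
  rw [h, poch_neg_natCast_eq_zero hn]

theorem descFactorial_add_cast (p q : ℕ) :
    ((p + q).descFactorial q : ℂ) = (p + q)! / p ! := by
  have hp : (p ! : ℂ) ≠ 0 := by exact_mod_cast p.factorial_ne_zero
  rw [eq_div_iff hp]
  have := Nat.factorial_mul_descFactorial (Nat.le_add_left q p)
  rw [Nat.add_sub_cancel] at this
  rw [← this]
  push_cast
  ring

/-- The summand of index `k` of the coefficient of `x ^ j`. -/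
theorem coefficient_eq_euler (a b c : ℂ) {M j k : ℕ} (hkj : k ≤ j) (hj : j < M)
    (hab : ∀ n : ℕ, n < M → a - b ≠ (n : ℂ)) :
    poch (1 - (M : ℂ)) j * poch (a - b - (M : ℂ) + 1) j / (poch (a + 1) j * (j ! : ℂ)) *
      ((-1) ^ k * poch (-(j : ℂ)) k * poch a k * poch b k * c
        / (poch (1 - (M : ℂ)) k * poch (a - b - (M : ℂ) + 1) k)
        * pFqOne ![(k : ℂ) - (M : ℂ), (k : ℂ) - (j : ℂ), 1 - b - (M : ℂ)]
          ![(k : ℂ) - (M : ℂ) + 1, a - b - (M : ℂ) + (k : ℂ) + 1])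
    = c * poch b k * poch a k / poch (a + 1) j
      * ((-1) ^ (j - k) * euler (M - k) (j - k) (a + k) (b + M)) := by
  obtain ⟨J, rfl⟩ := Nat.exists_eq_add_of_le hkj
  obtain ⟨L, rfl⟩ := Nat.exists_eq_add_of_lt hj
  have hfac : ∀ n : ℕ, (n ! : ℂ) ≠ 0 := fun n => by exact_mod_cast n.factorial_ne_zero
  -- Here `j = k + J` and `M = k + J + L + 1`. `D` is the second lower parameter of the `₃F₂`; the
  -- prefactor contributes `(D)_J`, which clears each denominator `(D)_i`.
  set D : ℂ := a - b - ((k + J + L + 1 : ℕ) : ℂ) + k + 1 with hD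
  have hDne : ∀ i ≤ J, poch D i ≠ 0 := fun i hi => poch_ne_zero fun n hn h => by
    refine hab (J + L - n) (by omega) ?_
    rw [hD] at h
    rw [Nat.cast_sub (by omega)]
    push_cast at h ⊢
    linear_combination h
  have h1 : poch (1 - ((k + J + L + 1 : ℕ) : ℂ)) (k + J)
      = poch (1 - ((k + J + L + 1 : ℕ) : ℂ)) k * poch (-((J + L : ℕ) : ℂ)) J := by
    rw [poch_add]
    congr 2
    push_cast
    ring
  have h2 : poch (a - b - ((k + J + L + 1 : ℕ) : ℂ) + 1) (k + J)
      = poch (a - b - ((k + J + L + 1 : ℕ) : ℂ) + 1) k * poch D J := by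
    rw [poch_add]
    congr 2
    rw [hD]
    ring
  have h1' : poch (1 - ((k + J + L + 1 : ℕ) : ℂ)) k ≠ 0 := poch_ne_zero fun n hn h => by
    have h' : ((n + 1 : ℕ) : ℂ) = ((k + J + L + 1 : ℕ) : ℂ) := by
      push_cast at h ⊢
      linear_combination h
    have := Nat.cast_injective h'
    omega
  have h2' : poch (a - b - ((k + J + L + 1 : ℕ) : ℂ) + 1) k ≠ 0 := poch_ne_zero fun n hn h => by
    refine hab (k + J + L - n) (by omega) ?_
    rw [Nat.cast_sub (by omega)]
    push_cast at h ⊢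
    linear_combination h
  have h3 : (-1) ^ k * poch (-((k + J : ℕ) : ℂ)) k = (k + J)! / J ! := by
    rw [poch_neg_natCast, add_comm k J, descFactorial_add_cast, ← mul_assoc, ← mul_pow]
    simp
  -- With `N = M - k`, the factors `(-N)_i / (1 - N)_i`, `(-J)_i / i!` and `(1 - N)_J / J!` combine
  -- to `(-1)^(J+i) * N.choose i * (N - i - 1).choose (J - i)`.
  have key : poch (-((J + L : ℕ) : ℂ)) J * poch D J / J ! *
      pFqOne ![(k : ℂ) - ((k + J + L + 1 : ℕ) : ℂ), (k : ℂ) - ((k + J : ℕ) : ℂ),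
          1 - b - ((k + J + L + 1 : ℕ) : ℂ)]
          ![(k : ℂ) - ((k + J + L + 1 : ℕ) : ℂ) + 1, D]
      = (-1) ^ J * euler (J + L + 1) J (a + k) (b + ((k + J + L + 1 : ℕ) : ℂ)) := by
    -- The upper parameter `k - j = -J` stops the series at `J`, before the Pochhammer symbol of the
    -- lower parameter `-(J + L)` can vanish.
    rw [pFqOne_eq_sum _ _ 1 J (by simp), euler, mul_sum, mul_sum]
    refine sum_congr rfl fun i hi => ?_
    obtain ⟨t, rfl⟩ := Nat.exists_eq_add_of_le (Nat.lt_succ_iff.1 (mem_range.1 hi))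
    simp only [coeff, Fin.prod_univ_succ, Fin.prod_univ_zero, Matrix.cons_val_zero,
      Matrix.cons_val_succ, mul_one]
    have e1 : (k : ℂ) - ((k + (i + t) + L + 1 : ℕ) : ℂ) = -(((t + L + 1) + i : ℕ) : ℂ) := by
      push_cast; ring
    have e2 : (k : ℂ) - ((k + (i + t) : ℕ) : ℂ) = -((t + i : ℕ) : ℂ) := by
      push_cast; ring
    have e3 : -((t + L + 1 + i : ℕ) : ℂ) + 1 = -(((t + L) + i : ℕ) : ℂ) := by
      push_cast; ring
    have e4 : 1 - b - ((k + (i + t) + L + 1 : ℕ) : ℂ)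
        = 1 - (b + ((k + (i + t) + L + 1 : ℕ) : ℂ)) := by ring
    have e5 : a + k - (b + ((k + (i + t) + L + 1 : ℕ) : ℂ)) + 1 = D := by
      rw [hD]; ring
    rw [e1, e2, e3, e4, e5, poch_neg_natCast, poch_neg_natCast, poch_neg_natCast,
      poch_neg_natCast, show i + t + L = L + (i + t) by ring, descFactorial_add_cast,
      descFactorial_add_cast, descFactorial_add_cast, descFactorial_add_cast,
      show L + (i + t) + 1 = i + (t + L + 1) by ring, Nat.cast_add_choose,
      show i + (t + L + 1) - i - 1 = t + L by omega, Nat.add_sub_cancel_left,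
      Nat.cast_add_choose, poch_add D i t, show L + (i + t) = t + L + i by ring,
      show i + (t + L + 1) = t + L + 1 + i by ring, show i + t = t + i by ring]
    have := hDne i (by omega)
    have := hfac (t + i)
    have := hfac (t + L + i)
    have := hfac (t + L)
    have := hfac (t + L + 1)
    have := hfac t
    have := hfac L
    have := hfac i
    have : ((-1 : ℂ)) ^ i ≠ 0 := by simp
    field_simp
  rw [show k + J + L + 1 - k = J + L + 1 by omega, Nat.add_sub_cancel_left, ← key, h1, h2, h3]
  have := hfac (k + J)
  have := hfac J
  field_simp

end GenHyp

/-! ### Newton interpolation and formal power series. -/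

namespace GenHyp

open Finset

/-- Newton's interpolation formula for a polynomial of degree at most `M`. -/
theorem newton_interpolation (P : Polynomial ℂ) (M : ℕ) (hP : P.natDegree ≤ M) (C : ℕ → ℂ)
    (hC : ∀ k, C k = (-1) ^ k / (k ! : ℂ)
      * ∑ i ∈ range (k + 1), poch (-(k : ℂ)) i * P.eval (i : ℂ) / (i ! : ℂ)) (z : ℂ) :
    P.eval z = ∑ k ∈ range (M + 1), C k * ((-1) ^ k * poch (-z) k) := by
  have hfac : ∀ n : ℕ, (n ! : ℂ) ≠ 0 := fun n => by exact_mod_cast n.factorial_ne_zero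
  -- Since `(-k)_i / i! = (-1)^i * k.choose i`, the sum in `hC` is the `k`-th forward difference at
  -- `0` up to sign.
  have hC' : ∀ k, C k = (fwdDiff 1)^[k] P.eval 0 / (k ! : ℂ) := by
    intro k
    rw [hC, fwdDiff_iter_eq_sum_shift, mul_sum, sum_div]
    refine sum_congr rfl fun i hi => ?_
    obtain ⟨t, rfl⟩ := Nat.exists_eq_add_of_le (Nat.lt_succ_iff.1 (mem_range.1 hi))
    rw [poch_neg_natCast, Nat.descFactorial_eq_factorial_mul_choose, Nat.add_sub_cancel_left]
    simp only [nsmul_eq_mul, mul_one, zero_add, zsmul_eq_mul]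
    have := hfac i
    have := hfac (i + t)
    have h2 : ((-1 : ℂ) ^ i) * (-1) ^ i = 1 := by rw [← mul_pow]; simp
    push_cast
    field_simp
    rw [pow_add]
    linear_combination (-1) ^ t * ((i + t).choose i : ℂ) * Polynomial.eval (i : ℂ) P * h2
  let Q : Polynomial ℂ := ∑ k ∈ range (M + 1),
    Polynomial.C (C k * (-1) ^ k) * (ascPochhammer ℂ k).comp (-Polynomial.X)
  have hQ : ∀ z, Q.eval z = ∑ k ∈ range (M + 1), C k * ((-1) ^ k * poch (-z) k) := by
    intro z
    simp [Q, Polynomial.eval_finsetSum, poch, mul_assoc]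
  rw [← hQ]
  congr 1
  refine Polynomial.eq_of_infinite_eval_eq P Q
    ((Set.infinite_range_of_injective (Nat.cast_injective (R := ℂ))).mono ?_)
  rintro _ ⟨n, rfl⟩
  have h := shift_eq_sum_fwdDiff_iter (1 : ℂ) P.eval n 0
  rw [nsmul_eq_mul, mul_one, zero_add] at h
  rw [Set.mem_ofPred_eq, h, hQ]
  have hz : ∀ k, M < k → (fwdDiff 1)^[k] P.eval (0 : ℂ) = 0 := fun k hk => by
    rw [Polynomial.fwdDiff_iter_eq_zero_of_degree_lt (by omega)]
    rfl
  have ht : ∀ k, n.choose k • (fwdDiff 1)^[k] P.eval (0 : ℂ)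
      = C k * ((-1) ^ k * poch (-(n : ℂ)) k) := by
    intro k
    rw [hC', poch_neg_natCast, Nat.descFactorial_eq_factorial_mul_choose, ← mul_assoc ((-1) ^ k),
      ← mul_pow, nsmul_eq_mul]
    have := hfac k
    push_cast
    field_simp
    simp
  -- The sums up to `n` and up to `M` differ by zero terms: `(-n)_k = 0` for `k > n`, and
  -- differences of order above `M` kill `P`.
  rcases le_total n M with hnM | hnM
  · rw [sum_congr rfl fun k _ => ht k]
    refine sum_subset (range_subset_range.2 (by omega)) fun k _ hk => ?_
    rw [poch_neg_natCast_eq_zero (by simpa using hk)]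
    simp
  · rw [← sum_congr rfl fun k _ => ht k]
    symm
    refine sum_subset (range_subset_range.2 (by omega)) fun k _ hk => ?_
    rw [hz k (by simpa using hk), smul_zero]

open PowerSeries

/-- The binomial series of `(1 - X) ^ (-s)`. -/
noncomputable def binom (s : ℂ) : PowerSeries ℂ := PowerSeries.mk fun n => poch s n / (n ! : ℂ)

theorem constantCoeff_binom (s : ℂ) : constantCoeff (binom s) = 1 := by
  rw [← coeff_zero_eq_constantCoeff_apply, binom, coeff_mk]
  simp [poch_zero]

theorem one_sub_X_mul_binom (s : ℂ) : (1 - X) * binom (s + 1) = binom s := by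
  ext n
  rcases n with _ | n
  · simp [sub_mul, binom, poch_zero]
  · have hfac : ∀ n : ℕ, (n ! : ℂ) ≠ 0 := fun n => by exact_mod_cast n.factorial_ne_zero
    rw [sub_mul, one_mul, map_sub, coeff_succ_X_mul, binom, binom, coeff_mk, coeff_mk, coeff_mk,
      poch_succ, poch_succ_left s, Nat.factorial_succ]
    have := hfac n
    have : (n : ℂ) + 1 ≠ 0 := by exact_mod_cast n.succ_ne_zero
    push_cast
    field_simp
    ring

theorem one_sub_X_pow_mul_binom (s : ℂ) (n : ℕ) : (1 - X) ^ n * binom (s + n) = binom s := by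
  induction n with
  | zero => simp
  | succ n ih =>
    rw [pow_succ, mul_assoc]
    push_cast
    rw [← add_assoc, one_sub_X_mul_binom, ih]

theorem one_sub_X_mul_derivative_binom (s : ℂ) :
    (1 - X) * d⁄dX ℂ (binom s) = PowerSeries.C s * binom s := by
  have h : d⁄dX ℂ (binom s) = PowerSeries.C s * binom (s + 1) := by
    ext n
    have hfac : (n ! : ℂ) ≠ 0 := by exact_mod_cast n.factorial_ne_zero
    have : (n : ℂ) + 1 ≠ 0 := by exact_mod_cast n.succ_ne_zero
    rw [coeff_derivative, coeff_C_mul, binom, binom, coeff_mk, coeff_mk, poch_succ_left,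
      Nat.factorial_succ]
    push_cast
    field_simp
  rw [h, mul_left_comm, one_sub_X_mul_binom]

theorem coeff_X_mul_derivative (F : PowerSeries ℂ) (n : ℕ) :
    PowerSeries.coeff n (X * d⁄dX ℂ F) = n * PowerSeries.coeff n F := by
  rcases n with _ | n
  · simp
  · rw [coeff_succ_X_mul, coeff_derivative]
    push_cast
    ring

theorem coeff_one_sub_X_pow (N n : ℕ) :
    PowerSeries.coeff n ((1 - X : PowerSeries ℂ) ^ N) = (-1) ^ n * (N.choose n : ℂ) := by
  induction N generalizing n with
  | zero =>
    rcases n with _ | n <;> simp [PowerSeries.coeff_one]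
  | succ N ih =>
    rw [pow_succ', sub_mul, one_mul, map_sub, ih]
    rcases n with _ | n
    · simp
    · rw [coeff_succ_X_mul, ih, Nat.choose_succ_succ]
      push_cast
      ring

/-- The power series `∑ c_k (b)_k X^k (1 - X)^(M - k)`. -/
noncomputable def numer (M : ℕ) (b : ℂ) (c : ℕ → ℂ) : PowerSeries ℂ :=
  ∑ k ∈ range (M + 1), PowerSeries.C (c k * poch b k) * (X ^ k * (1 - X) ^ (M - k))

theorem coeff_numer (M : ℕ) (b : ℂ) (c : ℕ → ℂ) (n : ℕ) :
    PowerSeries.coeff n (numer M b c) = ∑ k ∈ range (M + 1), if k ≤ n then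
      c k * poch b k * ((-1) ^ (n - k) * ((M - k).choose (n - k) : ℂ)) else 0 := by
  rw [numer, map_sum]
  refine sum_congr rfl fun k _ => ?_
  rw [coeff_C_mul, coeff_X_pow_mul', coeff_one_sub_X_pow]
  split_ifs <;> simp

theorem coeff_numer_of_le {M : ℕ} (b : ℂ) (c : ℕ → ℂ) {n : ℕ} (h : n ≤ M) :
    PowerSeries.coeff n (numer M b c) = ∑ k ∈ range (n + 1),
      c k * poch b k * ((-1) ^ (n - k) * ((M - k).choose (n - k) : ℂ)) := by
  rw [coeff_numer, ← sum_filter]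
  refine sum_congr ?_ fun _ _ => rfl
  ext k
  simp
  omega

theorem coeff_numer_of_lt {M : ℕ} (b : ℂ) (c : ℕ → ℂ) {n : ℕ} (h : M < n) :
    PowerSeries.coeff n (numer M b c) = 0 := by
  rw [coeff_numer]
  refine sum_eq_zero fun k hk => ?_
  have := mem_range.1 hk
  rw [Nat.choose_eq_zero_of_lt (by omega)]
  simp

/-- Each summand collapses to `c_k (b)_k X^k (1 - X)^(-b-k)`; then `(b)_k (b + k)_{n-k} = (b)_n` and
`n! / (n - k)! = (-1)^k (-n)_k`. -/
theorem binom_mul_numer (M : ℕ) (b : ℂ) (c : ℕ → ℂ) (n : ℕ) :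
    PowerSeries.coeff n (binom (b + M) * numer M b c)
      = poch b n / (n ! : ℂ) * ∑ k ∈ range (M + 1), c k * ((-1) ^ k * poch (-(n : ℂ)) k) := by
  rw [numer, mul_sum, map_sum, mul_sum]
  refine sum_congr rfl fun k hk => ?_
  have hk := Nat.lt_succ_iff.1 (mem_range.1 hk)
  have h : binom (b + M) * (PowerSeries.C (c k * poch b k) * (X ^ k * (1 - X) ^ (M - k)))
      = PowerSeries.C (c k * poch b k) * (X ^ k * binom (b + k)) := by
    rw [← one_sub_X_pow_mul_binom (b + k) (M - k), Nat.cast_sub hk,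
      show b + (k : ℂ) + (M - k) = b + M by ring]
    ring
  rw [h, coeff_C_mul, coeff_X_pow_mul', poch_neg_natCast]
  split_ifs with hkn
  · obtain ⟨t, rfl⟩ := Nat.exists_eq_add_of_le hkn
    have hfac : ∀ n : ℕ, (n ! : ℂ) ≠ 0 := fun n => by exact_mod_cast n.factorial_ne_zero
    rw [Nat.add_sub_cancel_left, binom, coeff_mk, poch_add, add_comm k t, descFactorial_add_cast,
      ← mul_assoc ((-1) ^ k), ← mul_pow]
    have := hfac t
    have := hfac (t + k)
    field_simp
    simp
  · rw [Nat.descFactorial_eq_zero_iff_lt.2 (by omega)]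
    simp

/-- If `G` satisfies the two-term recurrence with right-hand side `a * numer`, then
`(1 - X) ^ (-(b + M - 1)) * G` is determined coefficientwise. -/
theorem coeff_binom_mul_eq (M : ℕ) (a b : ℂ) (c : ℕ → ℂ) (G : PowerSeries ℂ)
    (h0 : PowerSeries.coeff 0 G = 1)
    (hc : c 0 = 1)
    (hG : ∀ n : ℕ, ((n : ℂ) + 1 + a) * PowerSeries.coeff (n + 1) G
      - ((n : ℂ) + 1 + a - b - M) * PowerSeries.coeff n G
        = a * PowerSeries.coeff (n + 1) (numer M b c)) (n : ℕ) :
    ((n : ℂ) + a) * PowerSeries.coeff n (binom (b + M - 1) * G)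
      = a * (poch b n / (n ! : ℂ)
        * ∑ k ∈ range (M + 1), c k * ((-1) ^ k * poch (-(n : ℂ)) k)) := by
  -- The recurrence as a differential equation; `h0` and `hc` supply its constant term.
  have hGs : (1 - X) * (X * d⁄dX ℂ G + PowerSeries.C a * G)
      + PowerSeries.C (b + M - 1) * (X * G) = PowerSeries.C a * numer M b c := by
    ext n
    have he : (1 - X) * (X * d⁄dX ℂ G + PowerSeries.C a * G)
      + PowerSeries.C (b + M - 1) * (X * G) = (X * d⁄dX ℂ G + PowerSeries.C a * G)
        - X * (X * d⁄dX ℂ G + PowerSeries.C a * G) + PowerSeries.C (b + M - 1) * (X * G) := by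
      ring
    rw [he, map_add, map_sub, map_add, coeff_C_mul, coeff_C_mul, coeff_C_mul,
      coeff_X_mul_derivative]
    rcases n with _ | n
    · simp only [coeff_zero_X_mul, h0]
      rw [coeff_numer_of_le _ _ (Nat.zero_le _)]
      simp [hc, poch_zero]
    · rw [coeff_succ_X_mul, coeff_succ_X_mul, map_add, coeff_X_mul_derivative, coeff_C_mul, ← hG]
      push_cast
      ring
  have hB := one_sub_X_mul_derivative_binom (b + M - 1)
  have hB' : (1 - X) * binom (b + M) = binom (b + M - 1) := by
    have := one_sub_X_mul_binom (b + M - 1)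
    rwa [sub_add_cancel] at this
  have hne : (1 - X : PowerSeries ℂ) ≠ 0 := fun h => by
    have := congrArg constantCoeff h
    simp at this
  -- Differentiating the binomial factor absorbs the term `(b + M - 1) X G`; both sides are compared
  -- after multiplication by `1 - X`.
  have hY : X * d⁄dX ℂ (binom (b + M - 1) * G) + PowerSeries.C a * (binom (b + M - 1) * G)
      = PowerSeries.C a * (binom (b + M) * numer M b c) := by
    refine mul_left_cancel₀ hne ?_
    rw [Derivation.leibniz, smul_eq_mul, smul_eq_mul]
    linear_combination X * G * hB + binom (b + M - 1) * hGs
      - PowerSeries.C a * numer M b c * hB'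
  have := congrArg (PowerSeries.coeff n) hY
  rw [map_add, coeff_X_mul_derivative, coeff_C_mul, coeff_C_mul, binom_mul_numer] at this
  rw [← this]
  ring

/-! ### Explicit solution of the recurrence. -/

/-- The Taylor coefficients of `(1 - x) ^ (b + M - 1)` times the hypergeometric function. -/
noncomputable def taylor (M : ℕ) (a b : ℂ) (c : ℕ → ℂ) (n : ℕ) : ℂ :=
  if n < M then ∑ k ∈ range (n + 1), c k * poch b k * poch a k / poch (a + 1) n
      * ((-1) ^ (n - k) * euler (M - k) (n - k) (a + k) (b + M))
  else (-1) ^ M * poch b M * (∑ k ∈ range (M + 1), c k * ((-1) ^ k * poch a k)) / poch (a + 1) M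
    * (poch (1 - b + a) (n - M) / poch (a + M + 1) (n - M))

/-- The two branches agree at `n = M`: `euler_self` gives `(b + k)_{M-k}`, which joins `(b)_k` to
form `(b)_M`. Hence the recurrence passes across the junction. -/
theorem taylor_of_le {M : ℕ} (a b : ℂ) (c : ℕ → ℂ) {n : ℕ} (h : n ≤ M) :
    taylor M a b c n = ∑ k ∈ range (n + 1), c k * poch b k * poch a k / poch (a + 1) n
      * ((-1) ^ (n - k) * euler (M - k) (n - k) (a + k) (b + M)) := by
  rw [taylor]
  split_ifs with h'
  · rfl
  · obtain rfl : n = M := by omega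
    rw [Nat.sub_self, poch_zero, poch_zero, div_one, mul_one, mul_sum, sum_div]
    refine sum_congr rfl fun k hk => ?_
    obtain ⟨t, rfl⟩ := Nat.exists_eq_add_of_le (Nat.lt_succ_iff.1 (mem_range.1 hk))
    rw [Nat.add_sub_cancel_left, euler_self,
      show b + ((k + t : ℕ) : ℂ) - t = b + k by push_cast; ring, poch_add, pow_add]
    have h2 : ((-1 : ℂ) ^ k) * (-1) ^ k = 1 := by rw [← mul_pow]; simp
    linear_combination c k * poch b k * poch a k / poch (a + 1) (k + t) * (-1) ^ t
      * poch (b + k) t * h2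

theorem taylor_zero (M : ℕ) (a b : ℂ) (c : ℕ → ℂ) : taylor M a b c 0 = c 0 := by
  rw [taylor_of_le _ _ _ (Nat.zero_le _)]
  simp [poch_zero, euler_zero]

/-- Below `M` it holds separately for each `k`: by `euler_succ_add` if `k ≤ n`, and directly for the
new summand `k = n + 1`. From `M` on, `numer` contributes nothing and only the ratio of consecutive
`₂F₁` coefficients matters. -/
theorem taylor_recurrence (M : ℕ) (a b : ℂ) (c : ℕ → ℂ) (ha : ∀ n : ℕ, a + 1 ≠ -(n : ℂ)) (n : ℕ) :
    ((n : ℂ) + 1 + a) * taylor M a b c (n + 1) - ((n : ℂ) + 1 + a - b - M) * taylor M a b c n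
        = a * PowerSeries.coeff (n + 1) (numer M b c) := by
  have hp : ∀ n, poch (a + 1) n ≠ 0 := fun n => poch_ne_zero fun i _ => ha i
  have hn1 : ∀ n : ℕ, (n : ℂ) + 1 + a ≠ 0 := fun n h => ha n (by linear_combination h)
  rcases Nat.lt_or_ge n M with h | h
  · have h' : n + 1 ≤ M := h
    rw [taylor_of_le _ _ _ h', taylor_of_le _ _ _ h.le, coeff_numer_of_le _ _ h', sum_range_succ,
      sum_range_succ _ (n + 1), mul_add, mul_add, mul_sum, mul_sum, mul_sum, add_sub_right_comm,
      ← sum_sub_distrib]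
    have hpa : poch a (n + 1) = a * poch (a + 1) n := poch_succ_left _ _
    congr 1
    · refine sum_congr rfl fun k hk => ?_
      obtain ⟨t, rfl⟩ := Nat.exists_eq_add_of_le (Nat.lt_succ_iff.1 (mem_range.1 hk))
      have he := euler_succ_add (M - k) t (by omega) (a + k) (b + M)
      rw [add_assoc k t 1, Nat.add_sub_cancel_left, Nat.add_sub_cancel_left, ← add_assoc k t 1,
        poch_succ (a + 1)]
      have hpa' : poch a k * poch (a + k) (t + 1) = a * poch (a + 1) (k + t) := by
        rw [← poch_add, ← hpa, add_assoc]
      have h1 := hp (k + t)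
      have h2 := hn1 (k + t)
      have h2' : a + 1 + ((k + t : ℕ) : ℂ) ≠ 0 := fun h => h2 (by linear_combination h)
      have e1 : (((k + t : ℕ) : ℂ) + 1 + a) * (c k * poch b k * poch a k
          / (poch (a + 1) (k + t) * (a + 1 + ((k + t : ℕ) : ℂ)))
          * ((-1) ^ (t + 1) * euler (M - k) (t + 1) (a + k) (b + M)))
          = c k * poch b k * poch a k / poch (a + 1) (k + t)
          * ((-1) ^ (t + 1) * euler (M - k) (t + 1) (a + k) (b + M)) := by
        field_simp
        ring
      rw [e1]
      push_cast
      have e2 : c k * poch b k * poch a k / poch (a + 1) (k + t)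
            * ((-1) ^ (t + 1) * euler (M - k) (t + 1) (a + k) (b + M))
          - ((k : ℂ) + t + 1 + a - b - M) * (c k * poch b k * poch a k / poch (a + 1) (k + t)
            * ((-1) ^ t * euler (M - k) t (a + k) (b + M)))
          = c k * poch b k * poch a k / poch (a + 1) (k + t) * (-1) ^ (t + 1)
            * (((M - k).choose (t + 1) : ℂ) * poch (a + k) (t + 1)) := by
        rw [← he]
        ring
      rw [e2]
      field_simp
      linear_combination c k * poch b k * ((M - k).choose (t + 1) : ℂ) * hpa'
    · simp only [Nat.sub_self, euler_zero, Nat.choose_zero_right, pow_zero]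
      rw [hpa, poch_succ (a + 1)]
      have h1 := hp n
      have h2 := hn1 n
      have h2' : a + 1 + (n : ℂ) ≠ 0 := fun h => h2 (by linear_combination h)
      field_simp
      push_cast
      ring
  · rw [coeff_numer_of_lt _ _ (by omega), taylor, taylor, if_neg (by omega), if_neg (by omega)]
    obtain ⟨t, rfl⟩ := Nat.exists_eq_add_of_le h
    rw [add_assoc M t 1, Nat.add_sub_cancel_left, Nat.add_sub_cancel_left, poch_succ, poch_succ]
    have h1 : poch (a + M + 1) t ≠ 0 := poch_ne_zero fun i _ h =>
      ha (M + i) (by push_cast; linear_combination h)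
    have h2 := hn1 (M + t)
    have h2' : a + M + 1 + (t : ℂ) ≠ 0 := fun h => h2 (by push_cast; linear_combination h)
    have h3 := hp M
    field_simp
    push_cast
    ring

end GenHyp

/-! ### The cut plane and the continuation of `₂F₁(1, c; d; x)`. -/

namespace GenHyp

open Finset Topology MeasureTheory

theorem one_sub_mem_slitPlane_iff {x : ℂ} : 1 - x ∈ Complex.slitPlane ↔ x ∈ cutPlane := by
  constructor
  · rintro h t ht rfl
    rcases Complex.mem_slitPlane_iff.1 h with h | h
    · simp at h
      linarith
    · simp at h
  · intro h
    by_contra hn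
    simp only [Complex.mem_slitPlane_iff, not_or, not_lt, not_not, Complex.sub_re, Complex.one_re,
      Complex.sub_im, Complex.one_im, zero_sub, neg_eq_zero] at hn
    exact h x.re (by linarith) (Complex.ext (by simp) (by simp [hn.2]))

theorem isOpen_cutPlane : IsOpen cutPlane := by
  have : cutPlane = (fun x : ℂ => 1 - x) ⁻¹' Complex.slitPlane := by
    ext x
    exact one_sub_mem_slitPlane_iff.symm
  rw [this]
  exact Complex.isOpen_slitPlane.preimage (by fun_prop)

/-- Star-shapedness about `0` gives connectedness and keeps the segments of Euler's integral inside
the domain. -/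
theorem mul_mem_cutPlane {x : ℂ} (hx : x ∈ cutPlane) {t : ℝ} (h0 : 0 ≤ t) (h1 : t ≤ 1) :
    (t : ℂ) * x ∈ cutPlane := by
  intro s hs h
  have ht : 0 < t := by
    rcases h0.eq_or_lt with rfl | h'
    · rw [Complex.ofReal_zero, zero_mul] at h
      have : (0 : ℝ) = s := by exact_mod_cast h
      linarith
    · exact h'
  refine hx (s / t) ((one_le_div ht).2 (h1.trans hs)) ?_
  have : (t : ℂ) ≠ 0 := by exact_mod_cast ht.ne'
  push_cast
  rw [eq_div_iff this, mul_comm, h]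

theorem mem_cutPlane_of_norm_lt_one {x : ℂ} (hx : ‖x‖ < 1) : x ∈ cutPlane := by
  rintro t ht rfl
  rw [Complex.norm_real, Real.norm_eq_abs] at hx
  linarith [le_abs_self t]

theorem isPreconnected_cutPlane : IsPreconnected cutPlane := by
  have h0 : (0 : ℂ) ∈ cutPlane := mem_cutPlane_of_norm_lt_one (by simp)
  have : StarConvex ℝ (0 : ℂ) cutPlane := by
    refine starConvex_zero_iff.2 fun x hx t h0 h1 => ?_
    rw [Complex.real_smul]
    exact mul_mem_cutPlane hx h0 h1
  exact (this.isPathConnected h0).isConnected.isPreconnected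

theorem IsHypergeometric.eqOn {q : ℕ} {A : Fin (q + 1) → ℂ} {B : Fin q → ℂ} {F G : ℂ → ℂ}
    (hF : IsHypergeometric A B F) (hG : IsHypergeometric A B G) : Set.EqOn F G cutPlane := by
  refine (hF.differentiableOn.analyticOnNhd isOpen_cutPlane).eqOn_of_preconnected_of_eventuallyEq
    (hG.differentiableOn.analyticOnNhd isOpen_cutPlane) isPreconnected_cutPlane
    (mem_cutPlane_of_norm_lt_one (x := 0) (by simp)) ?_
  filter_upwards [Metric.ball_mem_nhds (0 : ℂ) one_pos] with x hx
  have hx : ‖x‖ < 1 := by simpa using hx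
  exact (hF.hasSum x hx).unique (hG.hasSum x hx)

theorem IsHypergeometric.pFq {q : ℕ} {A : Fin (q + 1) → ℂ} {B : Fin q → ℂ} {F : ℂ → ℂ}
    (hF : IsHypergeometric A B F) : IsHypergeometric A B (pFq A B) := by
  have h : ∃ F : ℂ → ℂ, IsHypergeometric A B F := ⟨F, hF⟩
  rw [GenHyp.pFq, dif_pos h]
  exact h.choose_spec

theorem differentiableOn_one_sub_cpow (s : ℂ) :
    DifferentiableOn ℂ (fun x : ℂ => (1 - x) ^ s) cutPlane := fun _ hx =>
  ((differentiableAt_id.const_sub 1).cpow_const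
    (one_sub_mem_slitPlane_iff.2 hx)).differentiableWithinAt

theorem hasSum_binomial (s : ℂ) {x : ℂ} (hx : ‖x‖ < 1) :
    HasSum (fun n : ℕ => poch s n / (n ! : ℂ) * x ^ n) ((1 - x) ^ (-s)) := by
  have h := (Complex.one_div_one_sub_cpow_hasFPowerSeriesOnBall_zero s).hasSum (y := x)
    (by simpa [← ofReal_norm] using hx)
  simp only [zero_add] at h
  rw [Complex.cpow_neg, ← one_div]
  refine h.congr_fun fun n => ?_
  rw [FormalMultilinearSeries.ofScalars_apply_eq, smul_eq_mul, Ring.choose,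
    show s + (n : ℂ) - 1 - n + 1 = s by ring]
  congr 1
  have := Ring.factorial_nsmul_multichoose_eq_ascPochhammer s n
  rw [Polynomial.ascPochhammer_smeval_eq_eval, nsmul_eq_mul] at this
  rw [poch, ← this]
  have : (n ! : ℂ) ≠ 0 := by exact_mod_cast n.factorial_ne_zero
  field_simp

theorem continuousOn_comp_segment {g : ℂ → ℂ} (hg : ContinuousOn g cutPlane) {x : ℂ}
    (hx : x ∈ cutPlane) :
    ContinuousOn (fun t : ℝ => g (((1 - t : ℝ) : ℂ) * x)) (Set.uIcc 0 1) := by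
  refine hg.comp (by fun_prop) fun t ht => ?_
  rw [Set.uIcc_of_le zero_le_one] at ht
  exact mul_mem_cutPlane hx (by linarith [ht.2]) (by linarith [ht.1])

/-- Holomorphy of a weighted average along segments towards `0`. -/
theorem differentiableOn_integral {w : ℝ → ℂ} (hw : IntervalIntegrable w volume 0 1)
    {g : ℂ → ℂ} (hg : DifferentiableOn ℂ g cutPlane) :
    DifferentiableOn ℂ (fun x => ∫ t in (0 : ℝ)..1, w t * g (((1 - t : ℝ) : ℂ) * x)) cutPlane := by
  intro x₀ hx₀
  obtain ⟨ε, hε, hball⟩ := Metric.nhds_basis_closedBall.mem_iff.1 (isOpen_cutPlane.mem_nhds hx₀)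
  have hg' : ContinuousOn (deriv g) cutPlane := (hg.deriv isOpen_cutPlane).continuousOn
  -- The compact set swept out by the segments from `0` to points near `x₀`; a bound for `deriv g`
  -- on it, times `‖w‖`, dominates the differentiated integrand.
  let K : Set ℂ := (fun p : ℝ × ℂ => ((1 - p.1 : ℝ) : ℂ) * p.2) ''
    (Set.Icc 0 1 ×ˢ Metric.closedBall x₀ ε)
  have hK : IsCompact K :=
    (isCompact_Icc.prod (isCompact_closedBall x₀ ε)).image (by fun_prop)
  have hKc : K ⊆ cutPlane := by
    rintro _ ⟨⟨t, x⟩, ⟨ht, hx⟩, rfl⟩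
    exact mul_mem_cutPlane (hball hx) (by linarith [ht.2]) (by linarith [ht.1])
  obtain ⟨C, hC⟩ := hK.exists_bound_of_continuousOn (hg'.mono hKc)
  have hmeas : ∀ {h : ℂ → ℂ}, ContinuousOn h cutPlane → ∀ x ∈ cutPlane,
      AEStronglyMeasurable (fun t : ℝ => h (((1 - t : ℝ) : ℂ) * x))
        (volume.restrict (Set.uIoc 0 1)) := fun hh x hx =>
    ((continuousOn_comp_segment hh hx).mono Set.uIoc_subset_uIcc).aestronglyMeasurable
      measurableSet_uIoc
  have hwm : AEStronglyMeasurable w (volume.restrict (Set.uIoc 0 1)) :=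
    (intervalIntegrable_iff.1 hw).aestronglyMeasurable
  have := (intervalIntegral.hasDerivAt_integral_of_dominated_loc_of_deriv_le
    (μ := volume) (a := 0) (b := 1) (𝕜 := ℂ) (x₀ := x₀)
    (F := fun x t => w t * g (((1 - t : ℝ) : ℂ) * x))
    (F' := fun x t => w t * (deriv g (((1 - t : ℝ) : ℂ) * x) * ((1 - t : ℝ) : ℂ)))
    (bound := fun t => ‖w t‖ * C) (s := Metric.closedBall x₀ ε)
    (Metric.closedBall_mem_nhds x₀ hε) ?_ ?_ ?_ ?_ ?_ ?_).2
  · exact this.differentiableAt.differentiableWithinAt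
  · filter_upwards [isOpen_cutPlane.mem_nhds hx₀] with x hx
    exact hwm.mul (hmeas hg.continuousOn x hx)
  · exact hw.mul_continuousOn (continuousOn_comp_segment hg.continuousOn hx₀)
  · exact hwm.mul ((hmeas hg' x₀ hx₀).mul (by fun_prop))
  · refine Filter.Eventually.of_forall fun t ht x hx => ?_
    rw [Set.uIoc_of_le zero_le_one] at ht
    rw [norm_mul]
    refine mul_le_mul_of_nonneg_left ?_ (norm_nonneg _)
    have h1 := hC _ (Set.mem_image_of_mem _ (Set.mk_mem_prod (Set.Ioc_subset_Icc_self ht) hx))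
    have h2 : ‖((1 - t : ℝ) : ℂ)‖ ≤ 1 := by
      rw [Complex.norm_real, Real.norm_eq_abs, abs_le]
      constructor <;> linarith [ht.1, ht.2]
    rw [norm_mul]
    exact (mul_le_of_le_one_right (norm_nonneg _) h2).trans h1
  · exact hw.norm.mul_const C
  · refine Filter.Eventually.of_forall fun t ht x hx => ?_
    rw [Set.uIoc_of_le zero_le_one] at ht
    have hm : ((1 - t : ℝ) : ℂ) * x ∈ cutPlane :=
      mul_mem_cutPlane (hball hx) (by linarith [ht.2]) (by linarith [ht.1])
    have hd := (hg.differentiableAt (isOpen_cutPlane.mem_nhds hm)).hasDerivAt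
    have hl : HasDerivAt (fun x : ℂ => ((1 - t : ℝ) : ℂ) * x) ((1 - t : ℝ) : ℂ) x := by
      simpa using (hasDerivAt_id x).const_mul ((1 - t : ℝ) : ℂ)
    exact (hd.comp x hl).const_mul (w t)

theorem hasSum_integral {w : ℝ → ℂ} (hw : IntervalIntegrable w volume 0 1)
    {g : ℂ → ℂ} {γ : ℕ → ℂ} (hg : ∀ x : ℂ, ‖x‖ < 1 → HasSum (fun n => γ n * x ^ n) (g x))
    {x : ℂ} (hx : ‖x‖ < 1) :
    HasSum (fun n => (∫ t in (0 : ℝ)..1, w t * ((1 - t : ℝ) : ℂ) ^ n) * (γ n * x ^ n))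
      (∫ t in (0 : ℝ)..1, w t * g (((1 - t : ℝ) : ℂ) * x)) := by
  have hs : Summable fun n => ‖γ n * x ^ n‖ := (hg x hx).summable.norm
  have hle : ∀ t : ℝ, t ∈ Set.uIoc 0 1 → ‖((1 - t : ℝ) : ℂ)‖ ≤ 1 := fun t ht => by
    rw [Set.uIoc_of_le zero_le_one] at ht
    rw [Complex.norm_real, Real.norm_eq_abs, abs_le]
    constructor <;> linarith [ht.1, ht.2]
  have hwm : AEStronglyMeasurable w (volume.restrict (Set.uIoc 0 1)) :=
    (intervalIntegrable_iff.1 hw).aestronglyMeasurable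
  have := intervalIntegral.hasSum_integral_of_dominated_convergence (μ := volume) (a := 0) (b := 1)
    (F := fun n t => w t * ((1 - t : ℝ) : ℂ) ^ n * (γ n * x ^ n))
    (f := fun t => w t * g (((1 - t : ℝ) : ℂ) * x))
    (fun n t => ‖w t‖ * ‖γ n * x ^ n‖) ?_ ?_ ?_ ?_ ?_
  · simpa only [intervalIntegral.integral_mul_const] using this
  · exact fun n => (hwm.mul (by fun_prop)).mul_const _
  · refine fun n => Filter.Eventually.of_forall fun t ht => ?_
    rw [norm_mul, norm_mul, norm_pow]
    refine mul_le_mul_of_nonneg_right ?_ (norm_nonneg _)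
    exact mul_le_of_le_one_right (norm_nonneg _) (pow_le_one₀ (norm_nonneg _) (hle t ht))
  · exact Filter.Eventually.of_forall fun t _ => hs.mul_left _
  · simp_rw [tsum_mul_left]
    exact hw.norm.mul_const _
  · refine Filter.Eventually.of_forall fun t ht => ?_
    have h1 : ‖((1 - t : ℝ) : ℂ) * x‖ < 1 := by
      rw [norm_mul]
      exact (mul_le_of_le_one_left (norm_nonneg _) (hle t ht)).trans_lt hx
    refine ((hg _ h1).mul_left (w t)).congr_fun fun n => ?_
    rw [mul_pow]
    ring

theorem prod_range_add_eq_poch (z : ℂ) (n : ℕ) : ∏ j ∈ range n, (z + j) = poch z n := by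
  induction n with
  | zero => simp [poch_zero]
  | succ n ih => rw [prod_range_succ, ih, poch_succ]

/-- Analytic continuation of `₂F₁(1, c; d; x)`: Euler's integral if `1 < Re d`, and otherwise
`₂F₁(1, c; d; x) = 1 + (c / d) x ₂F₁(1, c + 1; d + 1; x)`. -/
theorem exists_continuation (k : ℕ) (c d : ℂ) (hd : ∀ n : ℕ, d ≠ -(n : ℂ)) (hk : 1 < d.re + k) :
    ∃ F : ℂ → ℂ, DifferentiableOn ℂ F cutPlane ∧
      ∀ x : ℂ, ‖x‖ < 1 → HasSum (fun n => poch c n / poch d n * x ^ n) (F x) := by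
  induction k generalizing c d with
  | zero =>
    have hre : 0 < (d - 1).re := by simpa using hk
    have hw : IntervalIntegrable (fun t : ℝ => (t : ℂ) ^ (d - 1 - 1)) volume 0 1 := by
      simpa using Complex.betaIntegral_convergent hre (v := 1) (by simp)
    refine ⟨fun x => (d - 1) * ∫ t in (0 : ℝ)..1, (t : ℂ) ^ (d - 1 - 1)
      * (fun y : ℂ => (1 - y) ^ (-c)) (((1 - t : ℝ) : ℂ) * x),
      (differentiableOn_integral hw (differentiableOn_one_sub_cpow (-c))).const_mul _,
      fun x hx => ?_⟩
    refine ((hasSum_integral hw (fun x hx => hasSum_binomial c hx) hx).mul_left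
      (d - 1)).congr_fun fun n => ?_
    -- The moments are beta integrals `B(d - 1, n + 1)`; multiplied by `d - 1` they equal `n! /
    -- (d)_n`, turning `(c)_n / n!` into `(c)_n / (d)_n`.
    have hb : ∫ t in (0 : ℝ)..1, (t : ℂ) ^ (d - 1 - 1) * ((1 - t : ℝ) : ℂ) ^ n
        = n ! / poch (d - 1) (n + 1) := by
      rw [← prod_range_add_eq_poch, ← Complex.betaIntegral_eval_nat_add_one_right hre,
        Complex.betaIntegral]
      simp [Complex.cpow_natCast]
    have h1 : d - 1 ≠ 0 := fun h => by simp [h] at hre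
    have h2 : poch d n ≠ 0 := poch_ne_zero fun i _ => hd i
    have hfac : (n ! : ℂ) ≠ 0 := by exact_mod_cast n.factorial_ne_zero
    rw [hb, poch_succ_left, sub_add_cancel]
    field_simp
  | succ k ih =>
    obtain ⟨F, hF, hFs⟩ := ih (c + 1) (d + 1)
      (fun n h => hd (n + 1) (by push_cast; linear_combination h))
      (by simpa [add_assoc, add_comm, add_left_comm] using hk)
    refine ⟨fun x => 1 + c / d * x * F x, ?_, fun x hx => ?_⟩
    · fun_prop
    · have h := ((hFs x hx).mul_left (c / d * x))
      have h' := (hasSum_nat_add_iff (f := fun n => poch c n / poch d n * x ^ n) 1).1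
        (h.congr_fun fun n => ?_)
      · simpa [poch_zero, add_comm] using h'
      · have h1 : d ≠ 0 := by simpa using hd 0
        have h2 : poch (d + 1) n ≠ 0 := poch_ne_zero fun i _ h =>
          hd (i + 1) (by push_cast; linear_combination h)
        rw [poch_succ_left, poch_succ_left, pow_succ]
        field_simp

theorem isHypergeometric_two_one (c d : ℂ) (hd : ∀ n : ℕ, d ≠ -(n : ℂ)) :
    IsHypergeometric ![1, c] ![d] (pFq ![1, c] ![d]) := by
  obtain ⟨k, hk⟩ := exists_nat_gt (1 - d.re)
  obtain ⟨F, hF, hFs⟩ := exists_continuation k c d hd (by linarith)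
  refine IsHypergeometric.pFq ⟨hF, fun x hx => (hFs x hx).congr_fun fun n => ?_⟩
  have hfac : (n ! : ℂ) ≠ 0 := by exact_mod_cast n.factorial_ne_zero
  have h1 : poch 1 n = n ! := by simp [poch, ascPochhammer_eval_one]
  simp only [coeff, Fin.prod_univ_succ, Fin.prod_univ_zero, Matrix.cons_val_zero,
    Matrix.cons_val_succ, mul_one, h1]
  field_simp

end GenHyp

/-! ### The interpolated polynomial and the hypergeometric coefficients. -/

namespace GenHyp

open Finset

/-- The polynomial `p` with `p(n) = ∏ (f_i + m_i)_n / (f_i)_n`. -/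
noncomputable def shiftPoly {r : ℕ} (f : Fin r → ℂ) (m : Fin r → ℕ) : Polynomial ℂ :=
  Polynomial.C (vpoch f m)⁻¹ * ∏ i, (ascPochhammer ℂ (m i)).comp (Polynomial.X + Polynomial.C (f i))

theorem eval_shiftPoly {r : ℕ} (f : Fin r → ℂ) (m : Fin r → ℕ) (z : ℂ) :
    (shiftPoly f m).eval z = vpoch (fun i => f i + z) m / vpoch f m := by
  simp [shiftPoly, Polynomial.eval_prod, vpoch, poch, div_eq_inv_mul, add_comm]

theorem natDegree_shiftPoly_le {r : ℕ} (f : Fin r → ℂ) (m : Fin r → ℕ) :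
    (shiftPoly f m).natDegree ≤ ∑ i, m i := by
  refine (Polynomial.natDegree_C_mul_le _ _).trans ((Polynomial.natDegree_prod_le _ _).trans ?_)
  refine sum_le_sum fun i _ => ?_
  rw [Polynomial.natDegree_comp, ascPochhammer_natDegree, Polynomial.natDegree_X_add_C, mul_one]

theorem vpoch_ne_zero {r : ℕ} {f : Fin r → ℂ} (hf : ∀ (i : Fin r) (n : ℕ), f i ≠ -(n : ℂ))
    (m : Fin r → ℕ) : vpoch f m ≠ 0 :=
  prod_ne_zero_iff.2 fun i _ => poch_ne_zero fun n _ => hf i n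

/-- Both `(f_i)_{m_i} (f_i + m_i)_n` and `(f_i)_n (f_i + n)_{m_i}` equal `(f_i)_{m_i + n}`. -/
theorem prod_poch_shift {r : ℕ} {f : Fin r → ℂ} (hf : ∀ (i : Fin r) (n : ℕ), f i ≠ -(n : ℂ))
    (m : Fin r → ℕ) (n : ℕ) :
    ∏ i, poch (shift f m i) n = (shiftPoly f m).eval (n : ℂ) * ∏ i, poch (f i) n := by
  rw [eval_shiftPoly, div_mul_eq_mul_div, eq_div_iff (vpoch_ne_zero hf m), vpoch, vpoch,
    ← prod_mul_distrib, ← prod_mul_distrib]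
  refine prod_congr rfl fun i _ => ?_
  rw [shift, mul_comm, ← poch_add, mul_comm, ← poch_add, add_comm]

theorem Ckr_eq {r : ℕ} {f : Fin r → ℂ} (hf : ∀ (i : Fin r) (n : ℕ), f i ≠ -(n : ℂ))
    (m : Fin r → ℕ) (k : ℕ) :
    Ckr f m k = (-1) ^ k / (k ! : ℂ)
      * ∑ i ∈ range (k + 1), poch (-(k : ℂ)) i * (shiftPoly f m).eval (i : ℂ) / (i ! : ℂ) := by
  rw [Ckr, pFqOne_eq_sum _ _ 0 k (by simp)]
  congr 1
  refine sum_congr rfl fun i _ => ?_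
  have h : ∏ j, poch (f j) i ≠ 0 := prod_ne_zero_iff.2 fun j _ => poch_ne_zero fun n _ => hf j n
  simp only [coeff, Fin.prod_univ_succ, Fin.cons_zero, Fin.cons_succ]
  rw [prod_poch_shift hf]
  field_simp

theorem Ckr_zero {r : ℕ} {f : Fin r → ℂ} (hf : ∀ (i : Fin r) (n : ℕ), f i ≠ -(n : ℂ))
    (m : Fin r → ℕ) : Ckr f m 0 = 1 := by
  have := vpoch_ne_zero hf m
  rw [Ckr_eq hf]
  simp [poch_zero, eval_shiftPoly, this]

theorem eval_shiftPoly_eq_sum {r : ℕ} {f : Fin r → ℂ}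
    (hf : ∀ (i : Fin r) (n : ℕ), f i ≠ -(n : ℂ)) (m : Fin r → ℕ) (z : ℂ) :
    (shiftPoly f m).eval z
      = ∑ k ∈ range (∑ i, m i + 1), Ckr f m k * ((-1) ^ k * poch (-z) k) :=
  newton_interpolation _ _ (natDegree_shiftPoly_le f m) _ (Ckr_eq hf m) z

theorem coeff_eq {r : ℕ} {f : Fin r → ℂ} (hf : ∀ (i : Fin r) (n : ℕ), f i ≠ -(n : ℂ))
    (m : Fin r → ℕ) (a b : ℂ) (n : ℕ) :
    coeff (Fin.cons a (Fin.cons b (shift f m))) (Fin.cons (a + 1) f) n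
      = poch a n / poch (a + 1) n * (poch b n / n ! * (shiftPoly f m).eval (n : ℂ)) := by
  have h : ∏ j, poch (f j) n ≠ 0 := prod_ne_zero_iff.2 fun j _ => poch_ne_zero fun i _ => hf j i
  rw [coeff, Fin.prod_univ_succ, Fin.prod_univ_succ, Fin.prod_univ_succ]
  simp only [Fin.cons_zero, Fin.cons_succ]
  rw [prod_poch_shift hf]
  rw [show ∀ p q r s t : ℂ, p / q * (r / s * t) = p * (r * t) / (q * s) by intros; ring]
  rw [← mul_div_mul_right (poch a n * (poch b n * (shiftPoly f m).eval (n : ℂ))) _ h]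
  congr 1 <;> ring

theorem hasSum_mul_coeff {F G : PowerSeries ℂ} {x A B : ℂ}
    (hA : HasSum (fun n => PowerSeries.coeff n F * x ^ n) A)
    (hB : HasSum (fun n => PowerSeries.coeff n G * x ^ n) B) :
    HasSum (fun n => PowerSeries.coeff n (F * G) * x ^ n) (A * B) := by
  have hs := summable_norm_sum_mul_antidiagonal_of_summable_norm hA.summable.norm hB.summable.norm
  have ht := tsum_mul_tsum_eq_tsum_sum_antidiagonal_of_summable_norm hA.summable.norm
    hB.summable.norm
  rw [hA.tsum_eq, hB.tsum_eq] at ht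
  rw [ht]
  refine hs.of_norm.hasSum.congr_fun fun n => ?_
  rw [PowerSeries.coeff_mul, sum_mul]
  refine sum_congr rfl fun p hp => ?_
  rw [← mem_antidiagonal.1 hp, pow_add]
  ring

/-- The right-hand side of the transformation formula, with its Taylor coefficients. -/
theorem hasSum_taylor (M : ℕ) (a b : ℂ) (c : ℕ → ℂ) {F₁ : ℂ → ℂ}
    (hF₁ : IsHypergeometric ![1, 1 - b + a] ![a + (M : ℂ) + 1] F₁) {x : ℂ} (hx : ‖x‖ < 1) :
    HasSum (fun n => taylor M a b c n * x ^ n)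
      (∑ j ∈ range M, taylor M a b c j * x ^ j
        + (-1) ^ M * poch b M * (∑ k ∈ range (M + 1), c k * ((-1) ^ k * poch a k))
          / poch (a + 1) M * x ^ M * F₁ x) := by
  rw [add_comm]
  refine (hasSum_nat_add_iff M).1 ?_
  refine ((hF₁.hasSum x hx).mul_left _).congr_fun fun n => ?_
  have hfac : (n ! : ℂ) ≠ 0 := by exact_mod_cast n.factorial_ne_zero
  have h1 : poch 1 n = n ! := by simp [poch, ascPochhammer_eval_one]
  rw [taylor, if_neg (by omega), Nat.add_sub_cancel, pow_add]
  simp only [coeff, Fin.prod_univ_succ, Fin.prod_univ_zero, Matrix.cons_val_zero,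
    Matrix.cons_val_succ, mul_one, h1]
  rw [mul_comm (poch (a + M + 1) n), mul_div_mul_left _ _ hfac]
  ring

/-- Any holomorphic `H` with the coefficients `taylor` yields the continuation, because the Cauchy
product with the binomial series is computed by `coeff_binom_mul_eq`. -/
theorem isHypergeometric_of_taylor {r : ℕ} {f : Fin r → ℂ}
    (hf : ∀ (i : Fin r) (n : ℕ), f i ≠ -(n : ℂ)) (m : Fin r → ℕ) (a b : ℂ)
    (ha : ∀ n : ℕ, a + 1 ≠ -(n : ℂ)) {H : ℂ → ℂ} (hH : DifferentiableOn ℂ H cutPlane)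
    (hHs : ∀ x : ℂ, ‖x‖ < 1 →
      HasSum (fun n => taylor (∑ i, m i) a b (Ckr f m) n * x ^ n) (H x)) :
    IsHypergeometric (Fin.cons a (Fin.cons b (shift f m))) (Fin.cons (a + 1) f)
      (fun x => (1 - x) ^ (-(b + ((∑ i, m i : ℕ) : ℂ) - 1)) * H x) := by
  refine ⟨(differentiableOn_one_sub_cpow _).mul hH, fun x hx => ?_⟩
  set M := ∑ i, m i with hM
  let G : PowerSeries ℂ := PowerSeries.mk (taylor M a b (Ckr f m))
  have hprod := hasSum_mul_coeff (F := binom (b + M - 1)) (G := G) (x := x)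
    ((hasSum_binomial (b + M - 1) hx).congr_fun fun n => by rw [binom, PowerSeries.coeff_mk])
    ((hHs x hx).congr_fun fun n => by rw [PowerSeries.coeff_mk])
  refine hprod.congr_fun fun n => ?_
  congr 1
  have h0 : PowerSeries.coeff 0 G = 1 := by
    rw [PowerSeries.coeff_mk, taylor_zero, Ckr_zero hf]
  rw [coeff_eq hf]
  -- The case `n = 0` is separate because `a = 0` is allowed, and then `n + a` cannot be cancelled.
  rcases Nat.eq_zero_or_pos n with rfl | hn
  · have := vpoch_ne_zero hf m
    rw [PowerSeries.coeff_zero_eq_constantCoeff_apply, map_mul, constantCoeff_binom,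
      ← PowerSeries.coeff_zero_eq_constantCoeff_apply, h0]
    simp [poch_zero, eval_shiftPoly, this]
  · have h := coeff_binom_mul_eq M a b (Ckr f m) G h0 (Ckr_zero hf m) (fun n => by
      rw [PowerSeries.coeff_mk, PowerSeries.coeff_mk]
      exact taylor_recurrence M a b _ ha n) n
    rw [← eval_shiftPoly_eq_sum hf] at h
    have hna : (n : ℂ) + a ≠ 0 := fun h => ha (n - 1) (by
      rw [Nat.cast_sub hn]
      push_cast
      linear_combination h)
    have hp : poch (a + 1) n ≠ 0 := poch_ne_zero fun i _ => ha i
    have e : poch a n * (a + n) = a * poch (a + 1) n := by rw [← poch_succ, poch_succ_left]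
    refine mul_left_cancel₀ hna ?_
    rw [h, ← mul_assoc, mul_div_assoc', show ((n : ℂ) + a) * poch a n = a * poch (a + 1) n by
      rw [← e]; ring, mul_div_cancel_right₀ _ hp]

end GenHyp

/-! ### The transformation formula on the cut plane. -/

theorem corollary4 (r : ℕ) (hr : 1 ≤ r) (m : Fin r → ℕ) (hm : ∀ i, 1 ≤ m i)
    (M : ℕ) (hM : M = ∑ i, m i)
    (a b : ℂ) (f : Fin r → ℂ)
    (hf : ∀ (i : Fin r) (n : ℕ), f i ≠ -(n : ℂ))
    (ha : ∀ n : ℕ, a + 1 ≠ -(n : ℂ))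
    (hab : ∀ n : ℕ, n < M → a - b ≠ (n : ℂ))
    (hfa : ∀ (i : Fin r) (n : ℕ), n < m i → f i - a ≠ -(n : ℂ)) :
    GenHyp.IsHypergeometric (Fin.cons a (Fin.cons b (GenHyp.shift f m))) (Fin.cons (a + 1) f)
      (GenHyp.pFq (Fin.cons a (Fin.cons b (GenHyp.shift f m))) (Fin.cons (a + 1) f)) ∧
    GenHyp.IsHypergeometric ![1, 1 - b + a] ![a + (M : ℂ) + 1]
      (GenHyp.pFq ![1, 1 - b + a] ![a + (M : ℂ) + 1]) ∧
    ∀ x ∈ GenHyp.cutPlane,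
      (1 - x) ^ (b + (M : ℂ) - 1) *
          GenHyp.pFq (Fin.cons a (Fin.cons b (GenHyp.shift f m))) (Fin.cons (a + 1) f) x =
        (∑ j ∈ Finset.range M,
          GenHyp.poch (1 - (M : ℂ)) j * GenHyp.poch (a - b - (M : ℂ) + 1) j
            / (GenHyp.poch (a + 1) j * (j ! : ℂ)) * GenHyp.Qhat a b f m M j * x ^ j) +
        x ^ M * (-1) ^ M * GenHyp.poch b M * GenHyp.vpoch (fun i => f i - a) m
            / (GenHyp.poch (a + 1) M * GenHyp.vpoch f m) *
          GenHyp.pFq ![1, 1 - b + a] ![a + (M : ℂ) + 1] x := by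
  have hF₁ := GenHyp.isHypergeometric_two_one (1 - b + a) (a + M + 1) fun n h =>
    ha (M + n) (by push_cast; linear_combination h)
  have hFd := hF₁.differentiableOn
  have hF := GenHyp.isHypergeometric_of_taylor hf m a b ha (H := fun x =>
      ∑ j ∈ Finset.range M, GenHyp.taylor M a b (GenHyp.Ckr f m) j * x ^ j
        + (-1) ^ M * GenHyp.poch b M
          * (∑ k ∈ Finset.range (M + 1), GenHyp.Ckr f m k * ((-1) ^ k * GenHyp.poch a k))
          / GenHyp.poch (a + 1) M * x ^ M * GenHyp.pFq ![1, 1 - b + a] ![a + (M : ℂ) + 1] x)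
    (by fun_prop) (fun x hx => by
      rw [← hM]
      exact GenHyp.hasSum_taylor M a b _ hF₁ hx)
  refine ⟨hF.pFq, hF₁, fun x hx => ?_⟩
  have h1 : 1 - x ≠ 0 := Complex.slitPlane_ne_zero (GenHyp.one_sub_mem_slitPlane_iff.2 hx)
  rw [hF.pFq.eqOn hF hx, ← hM, ← mul_assoc, ← Complex.cpow_add _ _ h1, add_neg_cancel,
    Complex.cpow_zero, one_mul]
  congr 1
  · refine Finset.sum_congr rfl fun j hj => ?_
    have hj := Finset.mem_range.1 hj
    rw [GenHyp.taylor, if_pos hj, GenHyp.Qhat, Finset.mul_sum]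
    congr 1
    refine Finset.sum_congr rfl fun k hk => ?_
    exact (GenHyp.coefficient_eq_euler a b _ (Nat.lt_succ_iff.1 (Finset.mem_range.1 hk)) hj
      hab).symm
  -- The Newton expansion at `z = -a` evaluates the sum of `C_k (-1)^k (a)_k` as `(f - a)_m /
  -- (f)_m`.
  · have h2 := GenHyp.eval_shiftPoly_eq_sum hf m (-a)
    rw [GenHyp.eval_shiftPoly, neg_neg, ← hM] at h2
    rw [← h2]
    simp only [← sub_eq_add_neg]
    congr 1
    have := GenHyp.vpoch_ne_zero hf m
    have : GenHyp.poch (a + 1) M ≠ 0 := GenHyp.poch_ne_zero fun i _ => ha i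
    field_simp
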